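/- Let $G_0$ be a linear reductive Lie group, that is, a closed subgroup with finitely many connected components of the general linear group $GL(E)$ of a finite-dimensional real inner product space $E$, stable under $g\mapsto g^*$, and let $\theta(g)=(g^*)^{-1}$ be its Cartan involution. Put $K=\{g\in G_0:\theta(g)=g\}$ and let $\mathfrak p$ be the space of self-adjoint elements of the Lie algebra of $G_0$. Let $G=K\ltimes_{\mathrm{Ad}}\mathfrak p$ be the Cartan motion group of $G_0$, i.e. the topological space $K\times\mathfrak p$ with multiplication $(k_1,X_1)(k_2,X_2)=(k_1k_2,\,X_1+\mathrm{Ad}(k_1)X_2)$, and let $\overline\theta(k,X)=(k,-X)$. Let $H$ be a closed subgroup of $G$. Then the following two conditions are equivalent. (i) $G/H$ admits a compact Clifford--Klein form, i.e. there is a discrete subgroup $\Gamma$ of $G$ that acts properly discontinuously and freely on $G/H$ and for which $\Gamma\backslash G/H$ is compact. (ii) There is a $\overline\theta$-stable connected subgroup $L$ of $G$ such that (a) $L\pitchfork H$, i.e. $L\cap SHS$ is relatively compact in $G$ for every compact subset $S$ of $G$; and (b) $L\backslash G/H$ is compact in the quotient topology. -/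

import Mathlib

open scoped Pointwise

section LinearReductive

variable {E : Type*} [NormedAddCommGroup E] [InnerProductSpace ℝ E] [CompleteSpace E]

/-- `G` is a linear reductive Lie group: a closed subgroup of the general linear group of `E` with
finitely many connected components that is stable under the adjoint of an inner product (the one
carried by `E`), hence under the Cartan involution `θ g = (g*)⁻¹`. Used for finite-dimensional
`E` only. -/
structure IsLinearReductive (G : Subgroup (E →L[ℝ] E)ˣ) : Prop where
  isClosed : IsClosed (G : Set (E →L[ℝ] E)ˣ)
  star_mem : ∀ g ∈ G, star g ∈ G
  finite_components : Finite (ConnectedComponents G)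

/-- The Cartan involution `θ g = (g*)⁻¹` of the general linear group; it restricts to the Cartan
involution of a linear reductive Lie group. -/
noncomputable def cartanInvolution (E : Type*) [NormedAddCommGroup E] [InnerProductSpace ℝ E] [CompleteSpace E] :
    (E →L[ℝ] E)ˣ →* (E →L[ℝ] E)ˣ where
  toFun g := (star g)⁻¹
  map_one' := by simp
  map_mul' a b := by simp [mul_inv_rev]

/-- The subgroup `K = {g ∈ G | θ g = g}`. -/
noncomputable def fixedSubgroup (G : Subgroup (E →L[ℝ] E)ˣ) : Subgroup (E →L[ℝ] E)ˣ :=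
  G ⊓ (cartanInvolution E).eqLocus (MonoidHom.id _)

/-- The Lie algebra `𝔤` of `G`: the velocities at `1` of the curves in `G` through `1`. -/
noncomputable def lieAlg (G : Subgroup (E →L[ℝ] E)ˣ) : Submodule ℝ (E →L[ℝ] E) where
  carrier := {X | ∃ γ : ℝ → (E →L[ℝ] E)ˣ, (∀ t, γ t ∈ G) ∧ γ 0 = 1 ∧
    HasDerivAt (fun t => (γ t : E →L[ℝ] E)) X 0}
  zero_mem' := ⟨fun _ => 1, fun _ => G.one_mem, rfl, hasDerivAt_const _ _⟩
  add_mem' := by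
    rintro X Y ⟨γ, hγ, hγ0, hX⟩ ⟨δ, hδ, hδ0, hY⟩
    refine ⟨fun t => γ t * δ t, fun t => G.mul_mem (hγ t) (hδ t), by simp [hγ0, hδ0], ?_⟩
    have h := hX.mul hY
    simp only [hγ0, hδ0, Units.val_one, mul_one, one_mul] at h
    exact h
  smul_mem' := by
    rintro c X ⟨γ, hγ, hγ0, hX⟩
    refine ⟨fun t => γ (c * t), fun t => hγ _, by simp [hγ0], ?_⟩
    have h1 : HasDerivAt (fun t : ℝ => c * t) c 0 := by
      simpa using (hasDerivAt_id (0 : ℝ)).const_mul c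
    have h2 : HasDerivAt (fun t => (γ t : E →L[ℝ] E)) X (c * 0) := by simpa using hX
    exact h2.scomp (0 : ℝ) h1

/-- The `(-1)`-eigenspace `𝔭` in `𝔤` of the differential `X ↦ -X*` of the Cartan involution. -/
noncomputable def pPart (G : Subgroup (E →L[ℝ] E)ˣ) : Submodule ℝ (E →L[ℝ] E) where
  carrier := {X | X ∈ lieAlg G ∧ -star X = -X}
  zero_mem' := ⟨(lieAlg G).zero_mem, by simp⟩
  add_mem' := by
    rintro X Y ⟨hX, hX'⟩ ⟨hY, hY'⟩
    refine ⟨(lieAlg G).add_mem hX hY, ?_⟩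
    rw [star_add, neg_add, hX', hY', neg_add]
  smul_mem' := by
    rintro c X ⟨hX, hX'⟩
    refine ⟨(lieAlg G).smul_mem c hX, ?_⟩
    rw [neg_inj] at hX' ⊢
    rw [star_smul, hX', star_trivial]

theorem conj_mem_pPart (G : Subgroup (E →L[ℝ] E)ˣ) {k : (E →L[ℝ] E)ˣ} (hk : k ∈ fixedSubgroup G)
    {X : E →L[ℝ] E} (hX : X ∈ pPart G) :
    (k : E →L[ℝ] E) * X * ((k⁻¹ : (E →L[ℝ] E)ˣ) : E →L[ℝ] E) ∈ pPart G := by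
  obtain ⟨⟨γ, hγ, hγ0, hd⟩, hs⟩ := hX
  obtain ⟨hkG, hkθ⟩ := hk
  refine ⟨⟨fun t => k * γ t * k⁻¹, fun t => G.mul_mem (G.mul_mem hkG (hγ t)) (G.inv_mem hkG),
    by simp [hγ0], ?_⟩, ?_⟩
  · simpa using (hd.const_mul (k : E →L[ℝ] E)).mul_const ((k⁻¹ : (E →L[ℝ] E)ˣ) : E →L[ℝ] E)
  · have h1 : (star k)⁻¹ = k := hkθ
    have h2 : star k = k⁻¹ := by rw [← h1, inv_inv, h1]
    have h3 : star (k : E →L[ℝ] E) = ((k⁻¹ : (E →L[ℝ] E)ˣ) : E →L[ℝ] E) := by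
      rw [← h2, Units.coe_star]
    have h4 : star ((k⁻¹ : (E →L[ℝ] E)ˣ) : E →L[ℝ] E) = (k : E →L[ℝ] E) := by
      rw [← h3, star_star]
    rw [neg_inj] at hs ⊢
    rw [star_mul, star_mul, h3, h4, hs, mul_assoc]

/-- The adjoint action `Ad(k) X = k X k⁻¹` of `K` on `𝔭`. -/
noncomputable def adP (G : Subgroup (E →L[ℝ] E)ˣ) (k : fixedSubgroup G) (X : pPart G) : pPart G :=
  ⟨((k : (E →L[ℝ] E)ˣ) : E →L[ℝ] E) * (X : E →L[ℝ] E) *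
    (((k : (E →L[ℝ] E)ˣ)⁻¹ : (E →L[ℝ] E)ˣ) : E →L[ℝ] E), conj_mem_pPart G k.2 X.2⟩

/-- The Cartan motion group `K ⋉ 𝔭` of `G`, with elements `(k, X)`. -/
@[ext] structure CartanMotionGroup (G : Subgroup (E →L[ℝ] E)ˣ) where
  rot : fixedSubgroup G
  vec : pPart G

namespace CartanMotionGroup

variable {G : Subgroup (E →L[ℝ] E)ˣ}

/-- The multiplication is `(k₁, X₁) (k₂, X₂) = (k₁ k₂, X₁ + Ad(k₁) X₂)`. -/
noncomputable instance : Mul (CartanMotionGroup G) := ⟨fun a b => ⟨a.rot * b.rot, a.vec + adP G a.rot b.vec⟩⟩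

noncomputable instance : One (CartanMotionGroup G) := ⟨⟨1, 0⟩⟩

noncomputable instance : Inv (CartanMotionGroup G) := ⟨fun a => ⟨a.rot⁻¹, -adP G a.rot⁻¹ a.vec⟩⟩

noncomputable instance : Group (CartanMotionGroup G) where
  mul_assoc a b c := CartanMotionGroup.ext (mul_assoc a.rot b.rot c.rot) <| Subtype.ext <| by
    change (a.vec : E →L[ℝ] E) + _ * (b.vec : E →L[ℝ] E) * _ + _ * (c.vec : E →L[ℝ] E) * _ =
      a.vec + _ * (b.vec + _ * (c.vec : E →L[ℝ] E) * _) * _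
    change _ + (((a.rot * b.rot : fixedSubgroup G) : (E →L[ℝ] E)ˣ) : E →L[ℝ] E) * _ *
      ((((a.rot * b.rot : fixedSubgroup G) : (E →L[ℝ] E)ˣ)⁻¹ : (E →L[ℝ] E)ˣ) : E →L[ℝ] E) = _
    simp only [Subgroup.coe_mul, mul_inv_rev, Units.val_mul]
    noncomm_ring
  one_mul a := CartanMotionGroup.ext (one_mul a.rot) <| Subtype.ext <| by
    change (0 : E →L[ℝ] E) + ((1 : (E →L[ℝ] E)ˣ) : E →L[ℝ] E) * (a.vec : E →L[ℝ] E) *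
      (((1 : (E →L[ℝ] E)ˣ)⁻¹ : (E →L[ℝ] E)ˣ) : E →L[ℝ] E) = a.vec
    simp
  mul_one a := CartanMotionGroup.ext (mul_one a.rot) <| Subtype.ext <| by
    change (a.vec : E →L[ℝ] E) + _ * (0 : E →L[ℝ] E) * _ = a.vec
    simp
  inv_mul_cancel a := CartanMotionGroup.ext (inv_mul_cancel a.rot) <| Subtype.ext <| by
    change -(_ * (a.vec : E →L[ℝ] E) * _) + _ * (a.vec : E →L[ℝ] E) * _ = 0
    exact neg_add_cancel _

/-- The topology of `K × 𝔭`. -/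
noncomputable instance : TopologicalSpace (CartanMotionGroup G) :=
  TopologicalSpace.induced (fun g => (g.rot, g.vec)) inferInstance

/-- The involution `(k, X) ↦ (k, -X)` of the Cartan motion group. -/
noncomputable def thetaBar (G : Subgroup (E →L[ℝ] E)ˣ) : CartanMotionGroup G ≃* CartanMotionGroup G where
  toFun g := ⟨g.rot, -g.vec⟩
  invFun g := ⟨g.rot, -g.vec⟩
  left_inv g := by simp
  right_inv g := by simp
  map_mul' a b := CartanMotionGroup.ext rfl <| Subtype.ext <| by
    change -((a.vec : E →L[ℝ] E) + _ * (b.vec : E →L[ℝ] E) * _) =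
      -(a.vec : E →L[ℝ] E) + _ * (-(b.vec : E →L[ℝ] E)) * _
    noncomm_ring

end CartanMotionGroup

end LinearReductive

section CliffordKlein

variable {M : Type*} [Group M] [TopologicalSpace M]

/-- The pair `(L, H)` is proper in `M`, written `L ⋔ H`: `L ∩ SHS` is relatively compact for every
compact `S`. -/
def IsProperPair (L H : Set M) : Prop :=
  ∀ S : Set M, IsCompact S → IsCompact (closure (L ∩ (S * H * S)))

/-- The double coset space `L \ M / H`, with the quotient topology of `M`, is compact. -/
def CompactDoubleCosetSpace (L H : Subgroup M) : Prop :=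
  @CompactSpace (DoubleCoset.Quotient (L : Set M) (H : Set M))
    (inferInstanceAs (TopologicalSpace (Quotient (DoubleCoset.setoid (L : Set M) (H : Set M)))))

/-- `Γ` is a discontinuous group for `M / H`: a discrete subgroup of `M` that acts on `M / H`
properly discontinuously and freely. -/
structure IsDiscontinuousGroup (Γ H : Subgroup M) : Prop where
  discrete : DiscreteTopology Γ
  properlyDiscontinuous : ProperlyDiscontinuousSMul Γ (M ⧸ H)
  free : ∀ (γ : Γ) (x : M ⧸ H), γ • x = x → γ = 1

/-- `M / H` admits a compact Clifford–Klein form `Γ \ M / H`. -/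
def AdmitsCompactCliffordKleinForm (H : Subgroup M) : Prop :=
  ∃ Γ : Subgroup M, IsDiscontinuousGroup Γ H ∧ CompactDoubleCosetSpace Γ H

end CliffordKlein

/-!
Both conditions depend on a subgroup of `G = K ⋉ 𝔭` only up to compact factors: if `L ⊆ L' C` and
`L' ⊆ L C'` with `C`, `C'` compact, then `L` is proper (cocompact) with respect to `H` if and only
if `L'` is (`IsProperPair.of_subset_mul`, `CompactDoubleCosetSpace.of_subset_mul`). Since `K` is
compact and acts on `𝔭` by isometries, two subgroups are related in this way as soon as their
`𝔭`-components stay at bounded distance from each other (`subset_mul_of_norm_vec_sub_le`). It is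
therefore enough to compare discrete subgroups, and `θ̄`-stable connected subgroups, with the
translation groups `{1} × W` of linear subspaces `W` of `𝔭`.

Let `L` be `θ̄`-stable and let `W` be the span of its `𝔭`-components. For `l = (k, X)` in `L` the
element `l θ̄(l)⁻¹ = (1, 2X)` is in `L`, so `L` contains a lattice `Γ` of `{1} × W`
(`AddSubgroup.exists_discrete_cobounded_in_span`). It is at bounded distance from `L`, and being
torsion-free it acts freely once it acts properly discontinuously
(`IsProperPair.isDiscontinuousGroup`).

Conversely, let `Γ` be discrete. As in Bieberbach's theorem, the elements of `Γ` whose rotation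
part is close to `1` commute (`commute_of_rotDist_le`): iterated commutators `⁅a, ⁅a, …, ⁅a, b⁆⁆⁆`
converge to `1`, so they are eventually trivial by discreteness. A positivity argument for the trace
(`commutatorElement_eq_one_of_commute`) descends from there to the rotation part of `⁅a, b⁆`, which
is then a translation, and invariance of the trace form shows that this translation is zero.
A commuting family of affine isometries acts by translations on a common affine subspace
(`exists_forall_apply_add_eq_zero`). With `W` the span of these translations, `{1} × W` is at
bounded distance from `Γ`, because elements of small rotation part represent all of `Γ` up to
finitely many factors (`exists_bound_rotDist_mul_inv_le`).
-/

open scoped commutatorElement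

/-! ### Properness and cocompactness up to compact factors -/

section ProperPairs

variable {M : Type*} [Group M] [TopologicalSpace M]

theorem compactDoubleCosetSpace_of_mul_eq_univ {L H : Subgroup M} {D : Set M} (hD : IsCompact D)
    (h : (L : Set M) * D * (H : Set M) = Set.univ) : CompactDoubleCosetSpace L H := by
  let _ : TopologicalSpace (DoubleCoset.Quotient (L : Set M) (H : Set M)) :=
    inferInstanceAs (TopologicalSpace (Quotient (DoubleCoset.setoid (L : Set M) (H : Set M))))
  refine ⟨?_⟩
  have hc : Continuous (DoubleCoset.mk L H) := continuous_quotient_mk'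
  refine (hD.image hc).of_isClosed_subset isClosed_univ fun q _ => ?_
  obtain ⟨g, rfl⟩ := Quotient.exists_rep q
  obtain ⟨_, ⟨l, hl, d, hd, rfl⟩, y, hy, rfl⟩ : g ∈ (L : Set M) * D * (H : Set M) :=
    h ▸ Set.mem_univ g
  exact ⟨d, hd, (DoubleCoset.eq L H _ _).2 ⟨l, hl, y, hy, rfl⟩⟩

variable [IsTopologicalGroup M]

theorem CompactDoubleCosetSpace.exists_mul_eq_univ [LocallyCompactSpace M] {L H : Subgroup M}
    (h : CompactDoubleCosetSpace L H) :
    ∃ D : Set M, IsCompact D ∧ (L : Set M) * D * (H : Set M) = Set.univ := by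
  let _ : TopologicalSpace (DoubleCoset.Quotient (L : Set M) (H : Set M)) :=
    inferInstanceAs (TopologicalSpace (Quotient (DoubleCoset.setoid (L : Set M) (H : Set M))))
  have hc : CompactSpace (DoubleCoset.Quotient (L : Set M) (H : Set M)) := h
  have hq : Topology.IsQuotientMap (DoubleCoset.mk L H) := isQuotientMap_quotient_mk'
  obtain ⟨S, hS, hS1⟩ := exists_compact_mem_nhds (1 : M)
  -- The saturation of an open set `O` is `L O H`, so `M → L \ M / H` is open.
  have hopen : ∀ g : M, IsOpen (DoubleCoset.mk L H '' (g • interior S)) := fun g => by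
    rw [← hq.isOpen_preimage]
    have : DoubleCoset.mk L H ⁻¹' (DoubleCoset.mk L H '' (g • interior S)) =
        (L : Set M) * (g • interior S) * (H : Set M) := by
      ext x
      constructor
      · rintro ⟨y, hy, hyx⟩
        obtain ⟨l, hl, k, hk, rfl⟩ := (DoubleCoset.eq L H _ _).1 hyx
        exact Set.mul_mem_mul (Set.mul_mem_mul hl hy) hk
      · rintro ⟨_, ⟨l, hl, y, hy, rfl⟩, k, hk, rfl⟩
        exact ⟨y, hy, (DoubleCoset.eq L H _ _).2 ⟨l, hl, k, hk, rfl⟩⟩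
    rw [this]
    exact ((isOpen_interior.smul g).mul_left).mul_right
  obtain ⟨t, ht⟩ := hc.isCompact_univ.elim_finite_subcover _ hopen (fun q _ => by
    obtain ⟨g, rfl⟩ := Quotient.exists_rep q
    exact Set.mem_iUnion.2 ⟨g, g, ⟨1, mem_interior_iff_mem_nhds.2 hS1, by simp⟩, rfl⟩)
  refine ⟨⋃ g ∈ t, g • S, t.isCompact_biUnion fun g _ => hS.smul g,
    Set.eq_univ_of_forall fun x => ?_⟩
  obtain ⟨g, hg, y, hy, hyx⟩ : ∃ g ∈ t, ∃ y ∈ g • interior S,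
      DoubleCoset.mk L H y = DoubleCoset.mk L H x := by
    simpa using ht (Set.mem_univ (DoubleCoset.mk L H x))
  obtain ⟨l, hl, k, hk, rfl⟩ := (DoubleCoset.eq L H _ _).1 hyx
  exact Set.mul_mem_mul (Set.mul_mem_mul hl
    (Set.mem_biUnion hg (Set.smul_set_mono interior_subset hy))) hk

/-- Cocompactness depends on the acting group only up to a compact factor. -/
theorem CompactDoubleCosetSpace.of_subset_mul [LocallyCompactSpace M] {L L' H : Subgroup M}
    {C : Set M} (h : CompactDoubleCosetSpace L H) (hC : IsCompact C)
    (hL : (L : Set M) ⊆ (L' : Set M) * C) : CompactDoubleCosetSpace L' H := by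
  obtain ⟨D, hD, hDu⟩ := h.exists_mul_eq_univ
  refine compactDoubleCosetSpace_of_mul_eq_univ (hC.mul hD) (Set.eq_univ_of_univ_subset ?_)
  rw [← hDu, ← mul_assoc]
  exact Set.mul_subset_mul_right (Set.mul_subset_mul_right hL)

/-- Properness depends on the first factor only up to a compact factor. -/
theorem IsProperPair.of_subset_mul [T2Space M] {L L' H C : Set M} (h : IsProperPair L' H)
    (hC : IsCompact C) (hL : L ⊆ L' * C) : IsProperPair L H := by
  intro S hS
  have hS' : IsCompact (S ∪ S * C⁻¹) := hS.union (hS.mul hC.inv)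
  refine ((h _ hS').mul hC).closure_of_subset ?_
  rintro x ⟨hx, y, ⟨s, hs, k, hk, rfl⟩, s', hs', rfl⟩
  obtain ⟨l, hl, c, hc, hlc⟩ := hL hx
  refine ⟨l, subset_closure ⟨hl, s * k, ⟨s, .inl hs, k, hk, rfl⟩, s' * c⁻¹,
    .inr ⟨s', hs', c⁻¹, by simpa using hc, rfl⟩, ?_⟩, c, hc, hlc⟩
  simp only at hlc ⊢
  rw [← mul_assoc, ← hlc, mul_inv_cancel_right]

/-- If `γ = s h s'` with `h` in `H`, then `γ` maps the coset of `s'⁻¹` to the coset of `s`. -/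
theorem IsDiscontinuousGroup.isProperPair [T2Space M] {Γ H : Subgroup M}
    (h : IsDiscontinuousGroup Γ H) : IsProperPair (Γ : Set M) (H : Set M) := by
  intro S hS
  have := h.properlyDiscontinuous
  have hq : Continuous ((↑) : M → M ⧸ H) := continuous_quotient_mk'
  have hfin := ProperlyDiscontinuousSMul.finite_disjoint_inter_image (Γ := Γ)
    (hS.inv.image hq) (hS.image hq)
  refine (hfin.image ((↑) : Γ → M)).isCompact.closure_of_subset ?_
  rintro x ⟨hx, y, ⟨s, hs, k, hk, rfl⟩, s', hs', rfl⟩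
  refine ⟨⟨_, hx⟩, ⟨(s : M ⧸ H), ⟨_, ⟨s'⁻¹, by simpa using hs', rfl⟩, ?_⟩, s, hs, rfl⟩, rfl⟩
  change (((s * k * s') * s'⁻¹ : M) : M ⧸ H) = s
  rw [mul_inv_cancel_right, QuotientGroup.mk_mul_of_mem _ hk]

theorem exists_isCompact_subset_image_mk [LocallyCompactSpace M] {H : Subgroup M}
    {T : Set (M ⧸ H)} (hT : IsCompact T) :
    ∃ S : Set M, IsCompact S ∧ T ⊆ ((↑) : M → M ⧸ H) '' S := by
  obtain ⟨S, hS, hS1⟩ := exists_compact_mem_nhds (1 : M)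
  obtain ⟨t, ht⟩ := hT.elim_finite_subcover
    (fun g : M => ((↑) : M → M ⧸ H) '' (g • interior S))
    (fun g => QuotientGroup.isOpenMap_coe _ (isOpen_interior.smul g)) (fun q _ => by
      obtain ⟨g, rfl⟩ := QuotientGroup.mk_surjective q
      exact Set.mem_iUnion.2 ⟨g, g, ⟨1, mem_interior_iff_mem_nhds.2 hS1, by simp⟩, rfl⟩)
  refine ⟨⋃ g ∈ t, g • S, t.isCompact_biUnion fun g _ => hS.smul g, ht.trans ?_⟩
  simp only [Set.image_iUnion]
  exact Set.iUnion₂_mono fun g _ => Set.image_mono (Set.smul_set_mono interior_subset)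

/-- A torsion-free discrete subgroup that is proper with respect to `H` is a discontinuous group for
`M / H`: the stabilizers are finite, hence trivial. -/
theorem IsProperPair.isDiscontinuousGroup [LocallyCompactSpace M] [T2Space M] {Γ H : Subgroup M}
    [DiscreteTopology Γ] (h : IsProperPair (Γ : Set M) (H : Set M))
    (htf : ∀ γ : Γ, IsOfFinOrder γ → γ = 1) : IsDiscontinuousGroup Γ H := by
  have hpd : ProperlyDiscontinuousSMul Γ (M ⧸ H) := by
    refine ⟨fun {T₁ T₂} hT₁ hT₂ => ?_⟩
    obtain ⟨S₁, hS₁, hTS₁⟩ := exists_isCompact_subset_image_mk hT₁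
    obtain ⟨S₂, hS₂, hTS₂⟩ := exists_isCompact_subset_image_mk hT₂
    have hcl : IsClosed (Γ : Set M) := inferInstance
    have hfin : (((↑) : Γ → M) ⁻¹' closure ((Γ : Set M) ∩
        ((S₂ ∪ S₁⁻¹) * (H : Set M) * (S₂ ∪ S₁⁻¹)))).Finite := by
      exact (hcl.isClosedEmbedding_subtypeVal.isCompact_preimage
        (h _ (hS₂.union hS₁.inv))).finite_of_discrete
    refine hfin.subset ?_
    rintro γ ⟨_, ⟨q, hq, rfl⟩, hq₂⟩
    obtain ⟨s₁, hs₁, rfl⟩ := hTS₁ hq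
    obtain ⟨s₂, hs₂, he⟩ := hTS₂ hq₂
    have hk : s₂⁻¹ * (γ * s₁) ∈ H := QuotientGroup.eq.1 he
    refine subset_closure ⟨γ.2, s₂ * (s₂⁻¹ * (γ * s₁)), ⟨s₂, .inl hs₂, _, hk, rfl⟩, s₁⁻¹,
      .inr (by simpa using hs₁), ?_⟩
    simp
  refine ⟨inferInstance, hpd, fun γ x hx => htf γ ?_⟩
  have hfin := ProperlyDiscontinuousSMul.finite_disjoint_inter_image (Γ := Γ)
    (isCompact_singleton (x := x)) (isCompact_singleton (x := x))
  -- All powers of `γ` fix `x`.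
  rw [← finite_powers]
  refine hfin.subset ?_
  rintro _ ⟨n, rfl⟩
  refine ⟨x, ⟨x, rfl, ?_⟩, rfl⟩
  have hst : γ ∈ MulAction.stabilizer Γ x := hx
  exact (MulAction.stabilizer Γ x).pow_mem hst n

end ProperPairs

/-! ### The compact group `K` and its adjoint action -/

section RotationGroup

variable {E : Type*} [NormedAddCommGroup E] [InnerProductSpace ℝ E] [CompleteSpace E]
  {G : Subgroup (E →L[ℝ] E)ˣ}

theorem star_coe_fixedSubgroup (k : fixedSubgroup G) :
    star ((k : (E →L[ℝ] E)ˣ) : E →L[ℝ] E) =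
      (((k : (E →L[ℝ] E)ˣ)⁻¹ : (E →L[ℝ] E)ˣ) : E →L[ℝ] E) := by
  have h : (star (k : (E →L[ℝ] E)ˣ))⁻¹ = (k : (E →L[ℝ] E)ˣ) := k.2.2
  rw [← Units.coe_star, ← h, inv_inv, h]

theorem coe_mem_unitary (k : fixedSubgroup G) :
    ((k : (E →L[ℝ] E)ˣ) : E →L[ℝ] E) ∈ unitary (E →L[ℝ] E) := by
  rw [Unitary.mem_iff, star_coe_fixedSubgroup]
  simp

theorem coe_inv_mem_unitary (k : fixedSubgroup G) :
    (((k : (E →L[ℝ] E)ˣ)⁻¹ : (E →L[ℝ] E)ˣ) : E →L[ℝ] E) ∈ unitary (E →L[ℝ] E) :=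
  coe_mem_unitary k⁻¹

/-- The norm is one unless `E` is trivial. -/
theorem norm_coe_le_one {u : E →L[ℝ] E} (hu : u ∈ unitary (E →L[ℝ] E)) : ‖u‖ ≤ 1 := by
  rw [← mul_one u, CStarRing.norm_mem_unitary_mul _ hu]
  exact ContinuousLinearMap.norm_id_le

/-- The group `K` is compact: it is closed in the units, which embed as a closed subset of
`A × Aᵒᵖ` by `u ↦ (u, u⁻¹)`, and both components of the image of `K` have norm at most one. -/
theorem compactSpace_fixedSubgroup [FiniteDimensional ℝ E]
    (hG : IsClosed (G : Set (E →L[ℝ] E)ˣ)) : CompactSpace (fixedSubgroup G) := by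
  have : ProperSpace (E →L[ℝ] E) := FiniteDimensional.proper ℝ _
  have hcl : IsClosed (fixedSubgroup G : Set (E →L[ℝ] E)ˣ) := by
    have h2 : Continuous (cartanInvolution E) := by
      change Continuous fun g : (E →L[ℝ] E)ˣ => (star g)⁻¹
      exact continuous_star.inv
    exact hG.inter (isClosed_eq h2 continuous_id)
  refine isCompact_iff_compactSpace.1 ?_
  rw [(Units.isClosedEmbedding_embedProduct (α := E →L[ℝ] E)).isCompact_iff]
  refine Metric.isCompact_of_isClosed_isBounded
    ((Units.isClosedEmbedding_embedProduct (α := E →L[ℝ] E)).isClosedMap _ hcl)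
    (Metric.isBounded_closedBall.subset (t := Metric.closedBall 0 1) ?_)
  rintro _ ⟨k, hk, rfl⟩
  rw [mem_closedBall_zero_iff]
  exact max_le (norm_coe_le_one (coe_mem_unitary ⟨k, hk⟩))
    (norm_coe_le_one (coe_inv_mem_unitary ⟨k, hk⟩))

theorem coe_adP (k : fixedSubgroup G) (X : pPart G) : (adP G k X : E →L[ℝ] E) =
    ((k : (E →L[ℝ] E)ˣ) : E →L[ℝ] E) * X * (((k : (E →L[ℝ] E)ˣ)⁻¹ : (E →L[ℝ] E)ˣ) : E →L[ℝ] E) := rfl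

theorem norm_adP (k : fixedSubgroup G) (X : pPart G) : ‖adP G k X‖ = ‖X‖ := by
  rw [← Submodule.norm_coe, ← Submodule.norm_coe, coe_adP,
    CStarRing.norm_mul_mem_unitary _ (coe_inv_mem_unitary k),
    CStarRing.norm_mem_unitary_mul _ (coe_mem_unitary k)]

variable (G) in
/-- The adjoint action of `K` on `𝔭` as a homomorphism into the linear endomorphisms. -/
noncomputable def adHom : fixedSubgroup G →* Module.End ℝ (pPart G) where
  toFun k :=
    { toFun := adP G k
      map_add' X Y := Subtype.ext (by simp [coe_adP, mul_add, add_mul])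
      map_smul' c X := Subtype.ext (by simp [coe_adP]) }
  map_one' := LinearMap.ext fun X => Subtype.ext (by simp [coe_adP])
  map_mul' k l := LinearMap.ext fun X => Subtype.ext (by simp [coe_adP, mul_assoc])

theorem norm_adHom (k : fixedSubgroup G) (X : pPart G) : ‖adHom G k X‖ = ‖X‖ := norm_adP k X

theorem coe_adHom (k : fixedSubgroup G) (X : pPart G) : (adHom G k X : E →L[ℝ] E) =
    ((k : (E →L[ℝ] E)ˣ) : E →L[ℝ] E) * X * (((k : (E →L[ℝ] E)ˣ)⁻¹ : (E →L[ℝ] E)ˣ) : E →L[ℝ] E) := rfl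

theorem norm_adHom_sub_le (k l : fixedSubgroup G) (X : pPart G) :
    ‖adHom G k X - adHom G l X‖ ≤
      2 * ‖((k : (E →L[ℝ] E)ˣ) : E →L[ℝ] E) - ((l : (E →L[ℝ] E)ˣ) : E →L[ℝ] E)‖ * ‖X‖ := by
  rw [← Submodule.norm_coe, ← Submodule.norm_coe, Submodule.coe_sub, coe_adHom, coe_adHom,
    ← star_coe_fixedSubgroup, ← star_coe_fixedSubgroup]
  set a := ((k : (E →L[ℝ] E)ˣ) : E →L[ℝ] E)
  set b := ((l : (E →L[ℝ] E)ˣ) : E →L[ℝ] E)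
  have ha : ‖a‖ ≤ 1 := norm_coe_le_one (coe_mem_unitary k)
  have hb : ‖b‖ ≤ 1 := norm_coe_le_one (coe_mem_unitary l)
  have hs : ∀ T : E →L[ℝ] E, ‖star T‖ = ‖T‖ := fun T => norm_star T
  calc ‖a * (X : E →L[ℝ] E) * star a - b * X * star b‖
      = ‖(a - b) * X * star a + b * X * star (a - b)‖ := by
        congr 1; rw [star_sub]; noncomm_ring
    _ ≤ ‖(a - b) * X * star a‖ + ‖b * X * star (a - b)‖ := norm_add_le _ _
    _ ≤ ‖a - b‖ * ‖(X : E →L[ℝ] E)‖ * 1 + 1 * ‖(X : E →L[ℝ] E)‖ * ‖a - b‖ := by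
        gcongr
        · refine (norm_mul_le _ _).trans ?_
          rw [hs]
          gcongr
          exact norm_mul_le _ _
        · refine (norm_mul_le _ _).trans ?_
          rw [hs]
          gcongr
          refine (norm_mul_le _ _).trans ?_
          gcongr
    _ = 2 * ‖a - b‖ * ‖(X : E →L[ℝ] E)‖ := by ring

/-- The adjoint action is jointly continuous. -/
theorem continuous_adHom :
    Continuous fun q : fixedSubgroup G × pPart G => adHom G q.1 q.2 := by
  refine Continuous.subtype_mk ?_ _
  have h1 : Continuous fun q : fixedSubgroup G × pPart G => (q.1 : (E →L[ℝ] E)ˣ) :=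
    continuous_subtype_val.comp continuous_fst
  exact ((Units.continuous_val.comp h1).mul (continuous_subtype_val.comp continuous_snd)).mul
    (Units.continuous_val.comp h1.inv)

end RotationGroup

/-! ### The topological group `K ⋉ 𝔭` -/

namespace CartanMotionGroup

variable {E : Type*} [NormedAddCommGroup E] [InnerProductSpace ℝ E] [CompleteSpace E]
  {G : Subgroup (E →L[ℝ] E)ˣ}

@[simp] theorem one_rot : (1 : CartanMotionGroup G).rot = 1 := rfl
@[simp] theorem one_vec : (1 : CartanMotionGroup G).vec = 0 := rfl
@[simp] theorem mul_rot (a b : CartanMotionGroup G) : (a * b).rot = a.rot * b.rot := rfl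
@[simp] theorem mul_vec (a b : CartanMotionGroup G) :
    (a * b).vec = a.vec + adHom G a.rot b.vec := rfl
@[simp] theorem inv_rot (a : CartanMotionGroup G) : a⁻¹.rot = a.rot⁻¹ := rfl
@[simp] theorem inv_vec (a : CartanMotionGroup G) : a⁻¹.vec = -adHom G a.rot⁻¹ a.vec := rfl

variable (G) in
/-- The identity map from the Cartan motion group to `K × 𝔭`. -/
def homeomorphProd : CartanMotionGroup G ≃ₜ fixedSubgroup G × pPart G where
  toFun g := (g.rot, g.vec)
  invFun q := ⟨q.1, q.2⟩
  left_inv _ := rfl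
  right_inv _ := rfl
  continuous_toFun := continuous_induced_dom
  continuous_invFun := continuous_induced_rng.2 continuous_id

theorem continuous_rot : Continuous (rot : CartanMotionGroup G → fixedSubgroup G) :=
  continuous_fst.comp (homeomorphProd G).continuous

theorem continuous_vec : Continuous (vec : CartanMotionGroup G → pPart G) :=
  continuous_snd.comp (homeomorphProd G).continuous

theorem continuous_mk {T : Type*} [TopologicalSpace T] {f : T → fixedSubgroup G} {g : T → pPart G}
    (hf : Continuous f) (hg : Continuous g) :
    Continuous fun t => (⟨f t, g t⟩ : CartanMotionGroup G) :=
  (homeomorphProd G).symm.continuous.comp (hf.prodMk hg)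

instance : IsTopologicalGroup (CartanMotionGroup G) where
  continuous_mul := by
    have h1 : Continuous fun q : CartanMotionGroup G × CartanMotionGroup G => q.1.rot :=
      continuous_rot.comp continuous_fst
    exact continuous_mk (h1.mul (continuous_rot.comp continuous_snd))
      ((continuous_vec.comp continuous_fst).add
        (continuous_adHom.comp (h1.prodMk (continuous_vec.comp continuous_snd))))
  continuous_inv := by
    exact continuous_mk continuous_rot.inv
      (continuous_adHom.comp (continuous_rot.inv.prodMk continuous_vec)).neg

instance : T2Space (CartanMotionGroup G) := (homeomorphProd G).isEmbedding.t2Space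

theorem isCompact_norm_vec_le [FiniteDimensional ℝ E] [CompactSpace (fixedSubgroup G)] (r : ℝ) :
    IsCompact {g : CartanMotionGroup G | ‖g.vec‖ ≤ r} := by
  have : ProperSpace (pPart G) := FiniteDimensional.proper ℝ _
  have h := (isCompact_univ (X := fixedSubgroup G)).prod
    (isCompact_closedBall (0 : pPart G) r)
  refine ((homeomorphProd G).isCompact_preimage.2 h).of_isClosed_subset
    (isClosed_le continuous_vec.norm continuous_const) fun g hg => ?_
  exact ⟨trivial, mem_closedBall_zero_iff.2 hg⟩

theorem locallyCompactSpace [FiniteDimensional ℝ E] [CompactSpace (fixedSubgroup G)] :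
    LocallyCompactSpace (CartanMotionGroup G) := by
  have : ProperSpace (pPart G) := FiniteDimensional.proper ℝ _
  exact (homeomorphProd G).isClosedEmbedding.locallyCompactSpace

end CartanMotionGroup

/-! ### The trace form and rotation parts of commutators -/

section TraceForm

variable {E : Type*} [NormedAddCommGroup E] [InnerProductSpace ℝ E]

variable (E) in
/-- The trace of a continuous endomorphism. -/
noncomputable def opTrace : (E →L[ℝ] E) →ₗ[ℝ] ℝ :=
  LinearMap.trace ℝ E ∘ₗ ContinuousLinearMap.coeLM ℝ

theorem opTrace_mul_comm (S T : E →L[ℝ] E) : opTrace E (S * T) = opTrace E (T * S) :=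
  LinearMap.trace_mul_comm ℝ (S : E →ₗ[ℝ] E) (T : E →ₗ[ℝ] E)

theorem mul_norm_sq_le_inner {B : E →L[ℝ] E} (v : E) :
    (1 - ‖B - 1‖) * ‖v‖ ^ 2 ≤ inner ℝ v (B v) := by
  have h1 : inner ℝ v (B v) = ‖v‖ ^ 2 + inner ℝ v ((B - 1) v) := by
    simp [inner_sub_right]
  have h2 : ‖v‖ * ‖(B - 1) v‖ ≤ ‖v‖ * (‖B - 1‖ * ‖v‖) := by
    gcongr
    exact (B - 1).le_opNorm v
  have h3 := (abs_le.1 (abs_real_inner_le_norm v ((B - 1) v))).1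
  rw [h1]
  nlinarith

variable [CompleteSpace E] {G : Subgroup (E →L[ℝ] E)ˣ}

/-- The image of `Ad(k) - 1` is orthogonal to the fixed vectors of `k` for the trace form. -/
theorem opTrace_mul_adHom_sub {k : fixedSubgroup G} {X : pPart G} (h : adHom G k X = X)
    (Y : pPart G) : opTrace E (X * (adHom G k Y - Y : pPart G)) = 0 := by
  have h1 : (X : E →L[ℝ] E) * ((k : (E →L[ℝ] E)ˣ) : E →L[ℝ] E) =
      ((k : (E →L[ℝ] E)ˣ) : E →L[ℝ] E) * X := by
    conv_lhs => rw [← h, coe_adHom]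
    simp [mul_assoc]
  rw [Submodule.coe_sub, mul_sub, map_sub, sub_eq_zero, coe_adHom, ← mul_assoc, ← mul_assoc, h1,
    opTrace_mul_comm, ← mul_assoc, ← mul_assoc]
  simp

variable [FiniteDimensional ℝ E]

/-- The trace of `S B S*` is the sum of the values `⟪v, B v⟫` at the vectors `v = S* e` for `e` in an
orthonormal basis, all of which are nonnegative. -/
theorem eq_zero_of_opTrace_mul_star_eq_zero {S B : E →L[ℝ] E} {c : ℝ} (hc : 0 < c)
    (hB : ∀ v, c * ‖v‖ ^ 2 ≤ inner ℝ v (B v)) (h : opTrace E (S * B * star S) = 0) : S = 0 := by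
  let e := stdOrthonormalBasis ℝ E
  have hsum : opTrace E (S * B * star S) = ∑ i, inner ℝ (star S (e i)) (B (star S (e i))) := by
    change LinearMap.trace ℝ E _ = _
    rw [LinearMap.trace_eq_sum_inner _ e]
    refine Finset.sum_congr rfl fun i _ => ?_
    rw [ContinuousLinearMap.star_eq_adjoint, ContinuousLinearMap.adjoint_inner_left]
    rfl
  have hnn : ∀ i, 0 ≤ inner ℝ (star S (e i)) (B (star S (e i))) := fun i =>
    (by positivity : 0 ≤ c * ‖star S (e i)‖ ^ 2).trans (hB _)
  rw [hsum, Finset.sum_eq_zero_iff_of_nonneg fun i _ => hnn i] at h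
  have h0 : star S = 0 := by
    refine ContinuousLinearMap.coe_injective (e.toBasis.ext fun i => ?_)
    have h1 := hB (star S (e i))
    rw [h i (Finset.mem_univ i)] at h1
    have h2 : ‖star S (e i)‖ ^ 2 ≤ 0 := by
      by_contra! h3
      exact absurd (mul_pos hc h3) h1.not_gt
    simpa using h2
  rw [← star_star S, h0, star_zero]

theorem eq_zero_of_opTrace_mul_self_eq_zero {S : E →L[ℝ] E} (hS : star S = S)
    (h : opTrace E (S * S) = 0) : S = 0 := by
  refine eq_zero_of_opTrace_mul_star_eq_zero (B := 1) one_pos (fun v => ?_) (by simpa [hS] using h)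
  simp

/-- If `c = ⁅a, b⁆` commutes with `a` then conjugation by `a^{±1}` sends `b` to `c^{±1} b`, so that
`tr ((1 - c) b (1 - c)*) = 2 tr b - tr (c b) - tr (c⁻¹ b) = 0`. For `b` close to `1` this forces
`c = 1`, because `⟪v, b v⟫` is then positive definite. -/
theorem commutatorElement_eq_one_of_commute {a b : fixedSubgroup G}
    (hb : ‖((b : (E →L[ℝ] E)ˣ) : E →L[ℝ] E) - 1‖ < 1) (h : Commute a ⁅a, b⁆) : ⁅a, b⁆ = 1 := by
  set c := ⁅a, b⁆ with hc
  have h1 : c * b = a * b * a⁻¹ := by rw [hc, commutatorElement_def]; group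
  have h2 : c⁻¹ * b = a⁻¹ * b * a := by
    have h3 : c⁻¹ = a⁻¹ * c⁻¹ * a := by rw [mul_assoc, ← h.inv_right.eq]; group
    rw [h3, hc, commutatorElement_def]; group
  let φ : fixedSubgroup G →* (E →L[ℝ] E) := (Units.coeHom _).comp (Subgroup.subtype _)
  have h3 : star (φ c) = φ c⁻¹ := star_coe_fixedSubgroup c
  have h4 : ∀ x y : fixedSubgroup G, opTrace E (φ (x * y * x⁻¹)) = opTrace E (φ y) := fun x y => by
    rw [map_mul, opTrace_mul_comm, ← map_mul]; group
  have h5 : opTrace E (φ (c * b)) = opTrace E (φ b) := by rw [h1, h4]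
  have h6 : opTrace E (φ (c⁻¹ * b)) = opTrace E (φ b) := by
    rw [h2]; simpa using h4 a⁻¹ b
  have h7 : φ c⁻¹ * φ c = 1 := by rw [← map_mul]; simp
  have h8 : opTrace E ((1 - φ c) * φ b * star (1 - φ c)) = 0 := by
    rw [opTrace_mul_comm, star_sub, star_one, h3]
    have : (1 - φ c⁻¹) * ((1 - φ c) * φ b) = φ b + φ b - φ (c * b) - φ (c⁻¹ * b) := by
      have e : ∀ x y z : E →L[ℝ] E, (1 - x) * ((1 - y) * z) = z - y * z - x * z + x * y * z :=
        fun x y z => by noncomm_ring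
      rw [e, h7, map_mul, map_mul]
      noncomm_ring
    rw [this, map_sub, map_sub, map_add, h5, h6]; ring
  have h9 := eq_zero_of_opTrace_mul_star_eq_zero (sub_pos.2 hb) mul_norm_sq_le_inner h8
  exact Subtype.ext (Units.ext (sub_eq_zero.1 h9).symm)

theorem eq_zero_of_opTrace_coe_mul_self_eq_zero {X : pPart G}
    (h : opTrace E ((X : E →L[ℝ] E) * X) = 0) : X = 0 :=
  Subtype.ext (eq_zero_of_opTrace_mul_self_eq_zero (neg_inj.1 X.2.2) h)

/-- The image of `Ad(k) - 1` meets its kernel trivially. -/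
theorem adHom_sub_one_apply_eq_zero {k : fixedSubgroup G} {X : pPart G}
    (h : (adHom G k - 1) ((adHom G k - 1) X) = 0) : (adHom G k - 1) X = 0 :=
  eq_zero_of_opTrace_coe_mul_self_eq_zero (opTrace_mul_adHom_sub (sub_eq_zero.1 h) X)

theorem adHom_sub_one_apply_eq_zero_of_pow {k : fixedSubgroup G} {X : pPart G} {m : ℕ}
    (h : ((adHom G k - 1) ^ m) X = 0) : (adHom G k - 1) X = 0 := by
  induction m with
  | zero => rw [show X = 0 from h, map_zero]
  | succ m ih =>
    cases m with
    | zero => simpa using h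
    | succ m =>
      refine ih ?_
      rw [pow_succ', pow_succ', Module.End.mul_apply, Module.End.mul_apply] at h
      rw [pow_succ', Module.End.mul_apply]
      exact adHom_sub_one_apply_eq_zero h

end TraceForm

namespace CartanMotionGroup

variable {E : Type*} [NormedAddCommGroup E] [InnerProductSpace ℝ E] [CompleteSpace E]
  {G : Subgroup (E →L[ℝ] E)ˣ}

/-- With `x = a`, `y = b` and `z = a⁻¹ b⁻¹` the difference `x y z - 1` is
`((x - 1) (y - 1) - (y - 1) (x - 1)) z`. -/
theorem norm_commutatorElement_sub_one_le (a b : fixedSubgroup G) :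
    ‖(((⁅a, b⁆ : fixedSubgroup G) : (E →L[ℝ] E)ˣ) : E →L[ℝ] E) - 1‖ ≤
      2 * ‖((a : (E →L[ℝ] E)ˣ) : E →L[ℝ] E) - 1‖ * ‖((b : (E →L[ℝ] E)ˣ) : E →L[ℝ] E) - 1‖ := by
  have key : ∀ x y z : E →L[ℝ] E, z ∈ unitary (E →L[ℝ] E) → y * x * z = 1 →
      ‖x * y * z - 1‖ ≤ 2 * ‖x - 1‖ * ‖y - 1‖ := fun x y z hz h => by
    have h2 : x * y * z - 1 = ((x - 1) * (y - 1) - (y - 1) * (x - 1)) * z := by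
      conv_lhs => rw [← h]
      noncomm_ring
    rw [h2, CStarRing.norm_mul_mem_unitary _ hz]
    refine (norm_sub_le _ _).trans ?_
    have := norm_mul_le (x - 1) (y - 1)
    have := norm_mul_le (y - 1) (x - 1)
    linarith
  convert key (a : (E →L[ℝ] E)ˣ) (b : (E →L[ℝ] E)ˣ)
    ((a⁻¹ * b⁻¹ : fixedSubgroup G) : (E →L[ℝ] E)ˣ) (coe_mem_unitary _) ?_ using 3
  · simp [commutatorElement_def, mul_assoc]
  · rw [← Units.val_mul, ← Units.val_mul, ← Subgroup.coe_mul, ← Subgroup.coe_mul,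
      show b * a * (a⁻¹ * b⁻¹) = 1 by group]
    rfl

end CartanMotionGroup

/-! ### Commuting families of affine maps -/

section CommutingFamily

variable {𝕜 V ι : Type*} [Field 𝕜] [AddCommGroup V] [Module 𝕜 V] [FiniteDimensional 𝕜 V]

/-- By induction on the dimension of an invariant affine subspace `z + U`: if some `f i` does not
vanish on `U`, then `z` can be moved inside `U` so that `z + (U ⊓ ker (f i))` is invariant. -/
theorem exists_forall_apply_add_eq_zero_aux {f : ι → Module.End 𝕜 V} {x : ι → V}
    (hcomm : ∀ i j v, f i (f j v) = f j (f i v)) (hsq : ∀ i v, f i (f i v) = 0 → f i v = 0)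
    (hx : ∀ i j, f i (x j) = f j (x i)) (n : ℕ) (U : Submodule 𝕜 V)
    (hn : Module.finrank 𝕜 U = n) (hU : ∀ i, ∀ u ∈ U, f i u ∈ U) (z : V)
    (hz : ∀ i, x i + f i z ∈ U) : ∃ z, ∀ i j, f i (x j + f j z) = 0 := by
  induction n using Nat.strong_induction_on generalizing U z with
  | _ n ih =>
    by_cases h0 : ∀ i, ∀ u ∈ U, f i u = 0
    · exact ⟨z, fun i j => h0 i _ (hz j)⟩
    push Not at h0
    obtain ⟨i, u₀, hu₀, hne⟩ := h0
    -- `f i` is injective on its range inside `U`, hence maps this range onto itself.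
    obtain ⟨u, hu, hu'⟩ : ∃ u ∈ U, f i (f i u) = -f i (x i + f i z) := by
      let g : Module.End 𝕜 U := (f i).restrict (hU i)
      let k : Module.End 𝕜 (LinearMap.range g) := g.restrict fun v _ => ⟨v, rfl⟩
      have hk : Function.Injective k := by
        rw [← LinearMap.ker_eq_bot, LinearMap.ker_eq_bot']
        rintro ⟨_, v, rfl⟩ hv
        have h1 : f i (f i v) = 0 := congrArg (fun w : LinearMap.range g => ((w : U) : V)) hv
        exact Subtype.ext (Subtype.ext (hsq i v h1))
      obtain ⟨⟨_, v, rfl⟩, hv⟩ := LinearMap.surjective_of_injective hk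
        ⟨g ⟨_, U.neg_mem (hz i)⟩, ⟨_, rfl⟩⟩
      refine ⟨v, v.2, ?_⟩
      have h1 : f i (f i v) = f i (-(x i + f i z)) :=
        congrArg (fun w : LinearMap.range g => ((w : U) : V)) hv
      rw [h1, map_neg]
    have hlt : U ⊓ LinearMap.ker (f i) < U := by
      refine lt_of_le_of_ne inf_le_left fun h => hne ?_
      exact (h.symm.le hu₀).2
    have hw : f i (x i + f i (z + u)) = 0 := by
      rw [map_add (f i) z, ← add_assoc, map_add (f i), hu', add_neg_cancel]
    refine ih _ (hn ▸ Submodule.finrank_lt_finrank_of_lt hlt) (U ⊓ LinearMap.ker (f i)) rfl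
      (fun j v hv => ⟨hU j v hv.1, ?_⟩) (z + u) (fun j => ⟨?_, ?_⟩)
    · change f i (f j v) = 0
      rw [hcomm, LinearMap.mem_ker.1 hv.2, map_zero]
    · rw [map_add, ← add_assoc]
      exact U.add_mem (hz j) (hU j u hu)
    -- With `w` the new value for the index `i`, `f i` maps the new value for `j` to `f j w`,
    -- and it kills `f j w` because it commutes with `f j` and kills `w`.
    · refine LinearMap.mem_ker.2 (hsq i _ ?_)
      have : f i (x j + f j (z + u)) = f j (x i + f i (z + u)) := by
        rw [map_add (f i), map_add (f j) (x i), hx i j, hcomm]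
      rw [this, hcomm, hw, map_zero]

/-- A commuting family of affine maps `v ↦ v + f i v + x i` whose linear parts satisfy
`ker (f i) ^ 2 = ker (f i)` acts by translations on an affine subspace with direction
`⋂ i, ker (f i)`. -/
theorem exists_forall_apply_add_eq_zero {f : ι → Module.End 𝕜 V} {x : ι → V}
    (hcomm : ∀ i j v, f i (f j v) = f j (f i v)) (hsq : ∀ i v, f i (f i v) = 0 → f i v = 0)
    (hx : ∀ i j, f i (x j) = f j (x i)) : ∃ z, ∀ i j, f i (x j + f j z) = 0 :=
  exists_forall_apply_add_eq_zero_aux hcomm hsq hx _ ⊤ rfl (fun _ _ _ => trivial) 0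
    fun _ => trivial

end CommutingFamily

/-! ### Commutators in discrete subgroups -/

namespace CartanMotionGroup

open Filter Topology

variable {E : Type*} [NormedAddCommGroup E] [InnerProductSpace ℝ E] [CompleteSpace E]
  {G : Subgroup (E →L[ℝ] E)ˣ}

/-- The distance of the rotation part of `g` to the identity, in the operator norm. -/
noncomputable def rotDist (g : CartanMotionGroup G) : ℝ :=
  ‖((g.rot : (E →L[ℝ] E)ˣ) : E →L[ℝ] E) - 1‖

@[simp] theorem commutatorElement_rot (a b : CartanMotionGroup G) : ⁅a, b⁆.rot = ⁅a.rot, b.rot⁆ :=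
  rfl

theorem rotDist_commutatorElement_le (a b : CartanMotionGroup G) :
    rotDist ⁅a, b⁆ ≤ 2 * rotDist a * rotDist b :=
  norm_commutatorElement_sub_one_le a.rot b.rot

theorem norm_adHom_sub_self_le (a : CartanMotionGroup G) (X : pPart G) :
    ‖adHom G a.rot X - X‖ ≤ 2 * rotDist a * ‖X‖ := by
  simpa [rotDist] using norm_adHom_sub_le a.rot 1 X

theorem norm_vec_commutatorElement_le (a b : CartanMotionGroup G) :
    ‖⁅a, b⁆.vec‖ ≤ 2 * rotDist b * ‖a.vec‖ + 2 * rotDist a * ‖b.vec‖ := by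
  set w := adHom G a.rot⁻¹ a.vec
  set v := adHom G b.rot⁻¹ b.vec
  have hw : adHom G a.rot w = a.vec := by
    rw [← Module.End.mul_apply, ← map_mul]; simp
  have hv : adHom G b.rot v = b.vec := by
    rw [← Module.End.mul_apply, ← map_mul]; simp
  -- Grouping the terms in `a.vec` and those in `b.vec` shows a displacement by `b` in the first
  -- group and one by `a` in the second.
  have h1 : ⁅a, b⁆.vec = adHom G (a.rot * b.rot * a.rot⁻¹) (adHom G a.rot v - v) -
      adHom G a.rot (adHom G b.rot w - w) := by
    rw [commutatorElement_def]
    simp only [mul_vec, mul_rot, inv_rot, inv_vec, map_mul, Module.End.mul_apply, map_sub, map_neg]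
    have h2 : adHom G a.rot⁻¹ (adHom G a.rot v) = v := by
      rw [← Module.End.mul_apply, ← map_mul]; simp
    rw [h2, hw, hv]
    abel
  rw [h1]
  have h3 := norm_adHom_sub_self_le a v
  have h4 := norm_adHom_sub_self_le b w
  rw [show ‖v‖ = ‖b.vec‖ from norm_adHom _ _] at h3
  rw [show ‖w‖ = ‖a.vec‖ from norm_adHom _ _] at h4
  refine (norm_sub_le _ _).trans ((add_comm _ _).trans_le (add_le_add ?_ ?_))
  · exact (norm_adHom _ _).trans_le h4
  · exact (norm_adHom _ _).trans_le h3

theorem tendsto_one_of_rotDist {b : ℕ → CartanMotionGroup G}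
    (h1 : Tendsto (fun n => rotDist (b n)) atTop (𝓝 0))
    (h2 : Tendsto (fun n => (b n).vec) atTop (𝓝 0)) : Tendsto b atTop (𝓝 1) := by
  rw [(homeomorphProd G).isInducing.tendsto_nhds_iff]
  refine Tendsto.prodMk_nhds ?_ h2
  rw [tendsto_subtype_rng, Units.isOpenEmbedding_val.tendsto_nhds_iff]
  exact tendsto_iff_norm_sub_tendsto_zero.2 h1

/-- In a discrete group the iterated commutators with an element of small rotation part become
trivial. They converge to the identity, since for small `η > 0` the quantity
`rotDist b + η ‖b.vec‖` is at least halved by `b ↦ ⁅a, b⁆`. -/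
theorem exists_iterate_commutatorElement_eq_one {Γ : Subgroup (CartanMotionGroup G)}
    [DiscreteTopology Γ] {a b : CartanMotionGroup G} (ha : a ∈ Γ) (hb : b ∈ Γ)
    (hsmall : rotDist a ≤ 1 / 8) : ∃ m : ℕ, (fun g => ⁅a, g⁆)^[m] b = 1 := by
  set c : ℕ → CartanMotionGroup G := fun m => (fun g => ⁅a, g⁆)^[m] b with hc
  have hsucc : ∀ m, c (m + 1) = ⁅a, c m⁆ := fun m => Function.iterate_succ_apply' _ _ _
  have hmem : ∀ m, c m ∈ Γ := fun m => by
    induction m with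
    | zero => exact hb
    | succ m ih =>
      rw [hsucc, commutatorElement_def]
      exact Γ.mul_mem (Γ.mul_mem (Γ.mul_mem ha ih) (Γ.inv_mem ha)) (Γ.inv_mem ih)
  -- This makes the contribution `2 η ‖a.vec‖ rotDist b` of `a.vec` at most `rotDist b / 4`.
  set η : ℝ := 1 / (8 * (‖a.vec‖ + 1)) with hη
  have hη0 : 0 < η := by positivity
  have hηa : η * ‖a.vec‖ ≤ 1 / 8 := by
    rw [hη, div_mul_eq_mul_div, div_le_div_iff₀ (by positivity) (by norm_num)]
    linarith
  set N : ℕ → ℝ := fun m => rotDist (c m) + η * ‖(c m).vec‖ with hN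
  have hrot0 : ∀ m, 0 ≤ rotDist (c m) := fun m => norm_nonneg _
  have hstep : ∀ m, N (m + 1) ≤ 1 / 2 * N m := fun m => by
    have e1 := rotDist_commutatorElement_le a (c m)
    have e2 := norm_vec_commutatorElement_le a (c m)
    have e3 : rotDist a * rotDist (c m) ≤ 1 / 8 * rotDist (c m) :=
      mul_le_mul_of_nonneg_right hsmall (hrot0 m)
    have e4 : rotDist a * (η * ‖(c m).vec‖) ≤ 1 / 8 * (η * ‖(c m).vec‖) :=
      mul_le_mul_of_nonneg_right hsmall (by positivity)
    have e5 : η * ‖a.vec‖ * rotDist (c m) ≤ 1 / 8 * rotDist (c m) :=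
      mul_le_mul_of_nonneg_right hηa (hrot0 m)
    have e6 := mul_le_mul_of_nonneg_left e2 hη0.le
    have e7 : 0 ≤ η * ‖(c m).vec‖ := by positivity
    simp only [hN, hsucc]
    linarith
  have hgeom : ∀ m, N m ≤ (1 / 2) ^ m * N 0 := fun m => by
    induction m with
    | zero => simp
    | succ m ih =>
      refine (hstep m).trans ?_
      rw [pow_succ']
      linarith
  have hlim : Tendsto (fun m => (1 / 2 : ℝ) ^ m * N 0) atTop (𝓝 0) := by
    simpa using (tendsto_pow_atTop_nhds_zero_of_lt_one (by norm_num : (0 : ℝ) ≤ 1 / 2)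
      (by norm_num)).mul_const (N 0)
  have hlimN : Tendsto N atTop (𝓝 0) :=
    squeeze_zero (fun m => add_nonneg (hrot0 m) (by positivity)) hgeom hlim
  have hc1 : Tendsto c atTop (𝓝 1) := by
    refine tendsto_one_of_rotDist
      (squeeze_zero hrot0 (fun m => le_add_of_nonneg_right (by positivity)) hlimN) ?_
    rw [tendsto_zero_iff_norm_tendsto_zero]
    have h := hlimN.const_mul η⁻¹
    rw [mul_zero] at h
    refine squeeze_zero (fun m => norm_nonneg _) (fun m => ?_) h
    rw [le_inv_mul_iff₀ hη0]
    exact le_add_of_nonneg_left (hrot0 m)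
  have hc2 : Tendsto (fun m => (⟨c m, hmem m⟩ : Γ)) atTop (𝓝 1) := tendsto_subtype_rng.2 hc1
  rw [nhds_discrete, tendsto_pure] at hc2
  obtain ⟨m, hm⟩ := hc2.exists
  exact ⟨m, congrArg Subtype.val hm⟩

theorem commutatorElement_mk_one (a : CartanMotionGroup G) (X : pPart G) :
    ⁅a, (⟨1, X⟩ : CartanMotionGroup G)⁆ = ⟨1, (adHom G a.rot - 1) X⟩ := by
  have h : adHom G a.rot (adHom G a.rot⁻¹ a.vec) = a.vec := by
    rw [← Module.End.mul_apply, ← map_mul]; simp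
  ext1
  · simp
  · simp [commutatorElement_def, h]
    abel

theorem iterate_commutatorElement_mk_one (a : CartanMotionGroup G) (X : pPart G) (m : ℕ) :
    (fun g => ⁅a, g⁆)^[m] (⟨1, X⟩ : CartanMotionGroup G) = ⟨1, ((adHom G a.rot - 1) ^ m) X⟩ := by
  induction m with
  | zero => simp
  | succ m ih =>
    rw [Function.iterate_succ_apply', ih, commutatorElement_mk_one, pow_succ', Module.End.mul_apply]

variable [FiniteDimensional ℝ E]

/-- Descending induction along the iterated commutators: if `a.rot` commutes with the rotation part
of `⁅a, b⁆`, then this rotation part is trivial by `commutatorElement_eq_one_of_commute`. -/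
theorem commute_rot_of_iterate_eq_one {a : CartanMotionGroup G} (ha : rotDist a ≤ 1 / 8) {m : ℕ}
    {b : CartanMotionGroup G} (hb : rotDist b < 1) (h : (fun g => ⁅a, g⁆)^[m] b = 1) :
    Commute a.rot b.rot := by
  induction m generalizing b with
  | zero =>
    rw [show b = 1 from h]
    exact Commute.one_right _
  | succ m ih =>
    have h1 : rotDist ⁅a, b⁆ < 1 := by
      have := rotDist_commutatorElement_le a b
      have h0 : 0 ≤ rotDist b := norm_nonneg _
      nlinarith
    have h2 : Commute a.rot ⁅a.rot, b.rot⁆ := ih h1 h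
    exact commutatorElement_eq_one_iff_commute.1 (commutatorElement_eq_one_of_commute hb h2)

/-- Elements with small rotation part of a discrete group commute: their rotation parts do, so that
the commutator is a translation `t`. It is fixed by the rotation parts of both elements, while it
lies in the orthogonal complement of the vectors with this property. -/
theorem commute_of_rotDist_le {Γ : Subgroup (CartanMotionGroup G)} [DiscreteTopology Γ]
    {a b : CartanMotionGroup G} (ha : a ∈ Γ) (hb : b ∈ Γ) (ha' : rotDist a ≤ 1 / 8)
    (hb' : rotDist b ≤ 1 / 8) : Commute a b := by
  obtain ⟨m, hm⟩ := exists_iterate_commutatorElement_eq_one ha hb ha'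
  have hrot : Commute a.rot b.rot := commute_rot_of_iterate_eq_one ha' (by linarith) hm
  have hrot1 : ⁅a.rot, b.rot⁆ = 1 := commutatorElement_eq_one_iff_commute.2 hrot
  set t := ⁅a, b⁆.vec with ht
  have hab : ⁅a, b⁆ = ⟨1, t⟩ := CartanMotionGroup.ext hrot1 rfl
  have hmem : (⟨1, t⟩ : CartanMotionGroup G) ∈ Γ := by
    rw [← hab, commutatorElement_def]
    exact Γ.mul_mem (Γ.mul_mem (Γ.mul_mem ha hb) (Γ.inv_mem ha)) (Γ.inv_mem hb)
  have hfix : ∀ g ∈ Γ, rotDist g ≤ 1 / 8 → adHom G g.rot t = t := fun g hg hg' => by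
    obtain ⟨k, hk⟩ := exists_iterate_commutatorElement_eq_one hg hmem hg'
    rw [iterate_commutatorElement_mk_one] at hk
    exact sub_eq_zero.1 (adHom_sub_one_apply_eq_zero_of_pow (congrArg vec hk))
  have hform : t = (adHom G a.rot b.vec - b.vec) - (adHom G b.rot a.vec - a.vec) := by
    have h1 : a * b = ⁅a, b⁆ * (b * a) := by rw [commutatorElement_def]; group
    have h2 := congrArg vec h1
    rw [hab] at h2
    simp only [mul_vec, map_one, Module.End.one_apply] at h2
    rw [eq_sub_of_add_eq h2.symm]
    abel
  have ht0 : t = 0 := by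
    refine eq_zero_of_opTrace_coe_mul_self_eq_zero ?_
    have h : opTrace E ((t : E →L[ℝ] E) * ((adHom G a.rot b.vec - b.vec) -
        (adHom G b.rot a.vec - a.vec) : pPart G)) = 0 := by
      rw [Submodule.coe_sub, mul_sub, map_sub, opTrace_mul_adHom_sub (hfix a ha ha'),
        opTrace_mul_adHom_sub (hfix b hb hb'), sub_zero]
    rwa [← hform] at h
  rw [← commutatorElement_eq_one_iff_commute, hab, ht0]
  rfl

end CartanMotionGroup

/-! ### Lattices in real spans -/

section Lattice

variable {V : Type*} [NormedAddCommGroup V] [NormedSpace ℝ V] [FiniteDimensional ℝ V]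

/-- Any additive subgroup `A` of `V` contains a lattice of its real span, spanned by a basis of
`span ℝ A` chosen in `A`. -/
theorem AddSubgroup.exists_discrete_cobounded_in_span (A : AddSubgroup V) :
    ∃ Λ : AddSubgroup V, Λ ≤ A ∧ DiscreteTopology Λ ∧
      ∃ R : ℝ, ∀ w ∈ Submodule.span ℝ (A : Set V), ∃ l ∈ Λ, ‖w - l‖ ≤ R := by
  obtain ⟨b, hbA, hspan, hli⟩ := exists_linearIndependent ℝ (A : Set V)
  have hfin : Finite b := hli.finite
  have := Fintype.ofFinite b
  refine ⟨(Submodule.span ℤ b).toAddSubgroup, ?_, ?_, ?_⟩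
  · have h : Submodule.span ℤ b ≤ A.toIntSubmodule := Submodule.span_le.2 hbA
    exact h
  · have hli' : LinearIndepOn ℝ id b := hli
    let e := Module.Basis.extend hli'
    have hfin' : Finite (hli'.extend (Set.subset_univ b)) := Module.Finite.finite_basis e
    have hd : DiscreteTopology (Submodule.span ℤ (Set.range e)) := inferInstance
    refine DiscreteTopology.of_subset (s := (Submodule.span ℤ (Set.range e) : Set V)) hd ?_
    refine Submodule.span_mono ?_
    rw [Module.Basis.range_extend hli']
    exact LinearIndepOn.subset_extend _ _
  · let B := Module.Basis.span hli
    refine ⟨∑ i, ‖B i‖, fun w hw => ?_⟩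
    have hw' : w ∈ Submodule.span ℝ (Set.range ((↑) : b → V)) := by
      rwa [Subtype.range_coe, hspan]
    refine ⟨((ZSpan.floor B ⟨w, hw'⟩ : Submodule.span ℝ (Set.range ((↑) : b → V))) : V), ?_, ?_⟩
    · have h : Submodule.span ℤ (Set.range B) ≤ (Submodule.span ℤ b).comap
          ((Submodule.span ℝ (Set.range ((↑) : b → V))).subtype.restrictScalars ℤ) := by
        rw [Submodule.span_le]
        rintro _ ⟨i, rfl⟩
        have hi : ((B i : Submodule.span ℝ (Set.range ((↑) : b → V))) : V) = i :=
          congrArg Subtype.val (Module.Basis.span_apply hli i)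
        change ((B i : Submodule.span ℝ (Set.range ((↑) : b → V))) : V) ∈ Submodule.span ℤ b
        rw [hi]
        exact Submodule.subset_span i.2
      exact h (ZSpan.floor B ⟨w, hw'⟩).2
    · exact ZSpan.norm_fract_le B ⟨w, hw'⟩

end Lattice

/-! ### Translation subgroups and displacements -/

namespace CartanMotionGroup

variable {E : Type*} [NormedAddCommGroup E] [InnerProductSpace ℝ E] [CompleteSpace E]
  {G : Subgroup (E →L[ℝ] E)ˣ}

/-- The subgroup `{1} × A` of the Cartan motion group. -/
def translations (A : AddSubgroup (pPart G)) : Subgroup (CartanMotionGroup G) where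
  carrier := {g | g.rot = 1 ∧ g.vec ∈ A}
  one_mem' := ⟨rfl, A.zero_mem⟩
  mul_mem' := by
    rintro a b ⟨ha, ha'⟩ ⟨hb, hb'⟩
    exact ⟨by simp [ha, hb], by simpa [ha] using A.add_mem ha' hb'⟩
  inv_mem' := by
    rintro a ⟨ha, ha'⟩
    exact ⟨by simp [ha], by simpa [ha] using ha'⟩

theorem map_thetaBar_translations (A : AddSubgroup (pPart G)) :
    (translations A).map (thetaBar G).toMonoidHom = translations A := by
  ext g
  constructor
  · rintro ⟨a, ⟨ha, ha'⟩, rfl⟩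
    exact ⟨ha, A.neg_mem ha'⟩
  · rintro ⟨hg, hg'⟩
    exact ⟨⟨g.rot, -g.vec⟩, ⟨hg, A.neg_mem hg'⟩, CartanMotionGroup.ext rfl (neg_neg _)⟩

theorem isConnected_translations (W : Submodule ℝ (pPart G)) :
    IsConnected (translations W.toAddSubgroup : Set (CartanMotionGroup G)) := by
  have h : IsConnected (W : Set (pPart G)) := W.convex.isConnected ⟨0, W.zero_mem⟩
  have hc : Continuous fun X : pPart G => (⟨1, X⟩ : CartanMotionGroup G) :=
    continuous_mk continuous_const continuous_id
  convert h.image _ hc.continuousOn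
  ext g
  constructor
  · rintro ⟨hg, hg'⟩
    exact ⟨g.vec, hg', CartanMotionGroup.ext hg.symm rfl⟩
  · rintro ⟨X, hX, rfl⟩
    exact ⟨rfl, hX⟩

theorem discreteTopology_translations (A : AddSubgroup (pPart G)) [DiscreteTopology A] :
    DiscreteTopology (translations A) := by
  refine DiscreteTopology.of_continuous_injective (β := A) (f := fun g => ⟨g.1.vec, g.2.2⟩)
    (Continuous.subtype_mk (continuous_vec.comp continuous_subtype_val) _) fun g h hgh => ?_
  exact Subtype.ext (CartanMotionGroup.ext (g.2.1.trans h.2.1.symm) (congrArg Subtype.val hgh))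

theorem eq_one_of_isOfFinOrder_of_mem_translations {A : AddSubgroup (pPart G)} (g : translations A)
    (h : IsOfFinOrder g) : g = 1 := by
  have hpow : ∀ n : ℕ, ((g : CartanMotionGroup G) ^ n).vec = n • (g : CartanMotionGroup G).vec :=
    fun n => by
      induction n with
      | zero => simp
      | succ n ih => rw [pow_succ', mul_vec, g.2.1, map_one, Module.End.one_apply, ih, succ_nsmul']
  obtain ⟨n, hn, hgn⟩ := isOfFinOrder_iff_pow_eq_one.1 h
  have h1 := hpow n
  rw [← Subgroup.coe_pow, hgn] at h1
  have h2 : (n : ℝ) • (g : CartanMotionGroup G).vec = 0 := by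
    rw [Nat.cast_smul_eq_nsmul]; exact h1.symm
  refine Subtype.ext (CartanMotionGroup.ext g.2.1 ?_)
  exact (smul_eq_zero.1 h2).resolve_left (by exact_mod_cast hn.ne')

theorem norm_inv_mul_vec (g h : CartanMotionGroup G) : ‖(g⁻¹ * h).vec‖ = ‖h.vec - g.vec‖ := by
  rw [← norm_adHom g.rot⁻¹ (h.vec - g.vec)]
  congr 1
  simp
  abel

theorem subset_mul_of_norm_vec_sub_le {S T : Set (CartanMotionGroup G)} {r : ℝ}
    (h : ∀ s ∈ S, ∃ t ∈ T, ‖s.vec - t.vec‖ ≤ r) : S ⊆ T * {g | ‖g.vec‖ ≤ r} := by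
  intro s hs
  obtain ⟨t, ht, hst⟩ := h s hs
  exact ⟨t, ht, t⁻¹ * s, (norm_inv_mul_vec t s).trans_le hst, mul_inv_cancel_left t s⟩

/-- The displacement `g z - z` of a point `z` of `𝔭`, on which the Cartan motion group acts by
affine isometries. -/
noncomputable def displacement (z : pPart G) (g : CartanMotionGroup G) : pPart G :=
  g.vec + adHom G g.rot z - z

theorem displacement_mul (z : pPart G) (g h : CartanMotionGroup G) :
    displacement z (g * h) = displacement z g + adHom G g.rot (displacement z h) := by
  simp [displacement]
  abel

theorem displacement_inv (z : pPart G) (g : CartanMotionGroup G) :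
    displacement z g⁻¹ = -adHom G g.rot⁻¹ (displacement z g) := by
  have h : adHom G g.rot⁻¹ (adHom G g.rot z) = z := by
    rw [← Module.End.mul_apply, ← map_mul]; simp
  simp [displacement, h]
  abel

theorem norm_displacement_sub_vec_le (z : pPart G) (g : CartanMotionGroup G) :
    ‖displacement z g - g.vec‖ ≤ 2 * ‖z‖ := by
  rw [displacement, add_sub_assoc, add_sub_cancel_left]
  refine (norm_sub_le _ _).trans_eq ?_
  rw [two_mul]
  exact congrArg (· + ‖z‖) (norm_adHom g.rot z)

/-- The displacements of `z` under those elements of `Γ` that act by translations on the affine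
subspace `z + U`. -/
noncomputable def displacementSubgroup (Γ : Subgroup (CartanMotionGroup G))
    (U : Submodule ℝ (pPart G)) (z : pPart G) : AddSubgroup (pPart G) where
  carrier := {w | w ∈ U ∧ ∃ g ∈ Γ, (∀ u ∈ U, adHom G g.rot u = u) ∧ displacement z g = w}
  zero_mem' := ⟨U.zero_mem, 1, Γ.one_mem, by simp, by simp [displacement]⟩
  add_mem' := by
    rintro _ _ ⟨hv, g, hg, hgU, rfl⟩ ⟨hw, h, hh, hhU, rfl⟩
    refine ⟨U.add_mem hv hw, g * h, Γ.mul_mem hg hh, fun u hu => ?_, ?_⟩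
    · rw [mul_rot, map_mul, Module.End.mul_apply, hhU u hu, hgU u hu]
    · rw [displacement_mul, hgU _ hw]
  neg_mem' := by
    rintro _ ⟨hv, g, hg, hgU, rfl⟩
    have hinv : ∀ u ∈ U, adHom G g.rot⁻¹ u = u := fun u hu => by
      conv_lhs => rw [← hgU u hu]
      rw [← Module.End.mul_apply, ← map_mul]
      simp
    refine ⟨U.neg_mem hv, g⁻¹, Γ.inv_mem hg, hinv, ?_⟩
    rw [displacement_inv, hinv _ hv]

variable [FiniteDimensional ℝ E]

/-- The elements of small rotation part of a discrete group commute, so they act by translations on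
a common affine subspace. -/
theorem exists_displacement_mem_displacementSubgroup (Γ : Subgroup (CartanMotionGroup G))
    [DiscreteTopology Γ] : ∃ (U : Submodule ℝ (pPart G)) (z : pPart G),
      ∀ g ∈ Γ, rotDist g ≤ 1 / 8 → displacement z g ∈ displacementSubgroup Γ U z := by
  let ι := {g : CartanMotionGroup G // g ∈ Γ ∧ rotDist g ≤ 1 / 8}
  let f : ι → Module.End ℝ (pPart G) := fun i => adHom G i.1.rot - 1
  have hcomm : ∀ i j : ι, i.1 * j.1 = j.1 * i.1 := fun i j =>
    commute_of_rotDist_le i.2.1 j.2.1 i.2.2 j.2.2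
  obtain ⟨z, hz⟩ := exists_forall_apply_add_eq_zero (f := f) (x := fun i => i.1.vec)
    (fun i j v => by
      have h1 : adHom G i.1.rot (adHom G j.1.rot v) = adHom G j.1.rot (adHom G i.1.rot v) := by
        rw [← Module.End.mul_apply, ← map_mul, ← mul_rot, hcomm i j, mul_rot, map_mul,
          Module.End.mul_apply]
      simp only [f, LinearMap.sub_apply, Module.End.one_apply, map_sub, h1]
      abel)
    (fun i v h => adHom_sub_one_apply_eq_zero h)
    (fun i j => by
      have h1 := congrArg vec (hcomm i j)
      simp only [mul_vec] at h1
      simp only [f, LinearMap.sub_apply, Module.End.one_apply]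
      rw [eq_sub_of_add_eq' h1]
      abel)
  have hdisp : ∀ j : ι, j.1.vec + f j z = displacement z j.1 := fun j => by
    simp only [f, LinearMap.sub_apply, Module.End.one_apply, displacement, add_sub_assoc]
  refine ⟨⨅ i, LinearMap.ker (f i), z, fun g hg hg' => ⟨?_, g, hg, fun u hu => ?_, rfl⟩⟩
  · rw [Submodule.mem_iInf]
    intro i
    rw [LinearMap.mem_ker, ← hdisp ⟨g, hg, hg'⟩]
    exact hz i ⟨g, hg, hg'⟩
  · have h := (Submodule.mem_iInf _).1 hu ⟨g, hg, hg'⟩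
    exact sub_eq_zero.1 h

/-- Elements of `Γ` with small rotation part represent all of `Γ` up to finitely many factors, by
total boundedness of the set of rotation parts. -/
theorem exists_bound_rotDist_mul_inv_le (Γ : Subgroup (CartanMotionGroup G)) {ε : ℝ} (hε : 0 < ε) :
    ∃ r : ℝ, ∀ g ∈ Γ, ∃ h ∈ Γ, rotDist (g * h⁻¹) ≤ ε ∧ ‖h.vec‖ ≤ r := by
  have : ProperSpace (E →L[ℝ] E) := FiniteDimensional.proper ℝ _
  let φ : CartanMotionGroup G → (E →L[ℝ] E) := fun g => ((g.rot : (E →L[ℝ] E)ˣ) : E →L[ℝ] E)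
  have htb : TotallyBounded (φ '' Γ) := by
    refine (isCompact_closedBall (0 : E →L[ℝ] E) 1).totallyBounded.subset ?_
    rintro _ ⟨g, -, rfl⟩
    exact mem_closedBall_zero_iff.2 (norm_coe_le_one (coe_mem_unitary g.rot))
  obtain ⟨t, htΓ, htfin, hcov⟩ := Metric.finite_approx_of_totallyBounded htb ε hε
  obtain ⟨F, hFΓ, hFfin, rfl⟩ := htfin.exists_subset_finite_image_eq htΓ
  obtain ⟨r, hr⟩ := (hFfin.image fun g => ‖g.vec‖).bddAbove
  refine ⟨r, fun g hg => ?_⟩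
  obtain ⟨_, ⟨h, hh, rfl⟩, hgh⟩ : ∃ y ∈ φ '' F, φ g ∈ Metric.ball y ε := by
    simpa using hcov ⟨g, hg, rfl⟩
  refine ⟨h, hFΓ hh, ?_, hr ⟨h, hh, rfl⟩⟩
  rw [mem_ball_iff_norm] at hgh
  refine le_of_eq_of_le ?_ hgh.le
  rw [← CStarRing.norm_mul_mem_unitary (φ g - φ h) (coe_inv_mem_unitary h.rot), sub_mul]
  simp [rotDist, φ]

end CartanMotionGroup

/-! ### Compact Clifford–Klein forms -/

open CartanMotionGroup in
theorem mainTheorem3 {E : Type*} [NormedAddCommGroup E] [InnerProductSpace ℝ E] [CompleteSpace E]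
    [FiniteDimensional ℝ E] (G : Subgroup (E →L[ℝ] E)ˣ) (hG : IsLinearReductive G)
    (H : Subgroup (CartanMotionGroup G)) (hH : IsClosed (H : Set (CartanMotionGroup G))) :
    AdmitsCompactCliffordKleinForm H ↔
      ∃ L : Subgroup (CartanMotionGroup G),
        L.map (CartanMotionGroup.thetaBar G).toMonoidHom = L ∧
        IsConnected (L : Set (CartanMotionGroup G)) ∧
        IsProperPair (L : Set (CartanMotionGroup G)) (H : Set (CartanMotionGroup G)) ∧
        CompactDoubleCosetSpace L H := by
  have := compactSpace_fixedSubgroup hG.isClosed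
  have := locallyCompactSpace (G := G)
  constructor
  · rintro ⟨Γ, hΓ, hΓc⟩
    have := hΓ.discrete
    obtain ⟨U, z, hUz⟩ := exists_displacement_mem_displacementSubgroup Γ
    obtain ⟨r, hr⟩ := exists_bound_rotDist_mul_inv_le Γ (by norm_num : (0 : ℝ) < 1 / 8)
    set A := displacementSubgroup Γ U z
    obtain ⟨Λ, hΛA, -, R, hR⟩ := A.exists_discrete_cobounded_in_span
    let W : Submodule ℝ (pPart G) := Submodule.span ℝ (A : Set (pPart G))
    have hW : (translations W.toAddSubgroup : Set (CartanMotionGroup G)) ⊆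
        (Γ : Set (CartanMotionGroup G)) * {g | ‖g.vec‖ ≤ R + 2 * ‖z‖} := by
      refine subset_mul_of_norm_vec_sub_le fun w hw => ?_
      obtain ⟨l, hl, hwl⟩ := hR w.vec hw.2
      obtain ⟨-, g, hg, -, rfl⟩ := hΛA hl
      refine ⟨g, hg, ?_⟩
      rw [← sub_add_sub_cancel _ (displacement z g)]
      exact (norm_add_le _ _).trans (add_le_add hwl (norm_displacement_sub_vec_le z g))
    have hΓW : (Γ : Set (CartanMotionGroup G)) ⊆
        (translations W.toAddSubgroup : Set (CartanMotionGroup G)) *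
          {g | ‖g.vec‖ ≤ r + 2 * ‖z‖} := by
      refine subset_mul_of_norm_vec_sub_le fun g hg => ?_
      obtain ⟨h, hh, hgh, hhr⟩ := hr g hg
      set s := g * h⁻¹
      have hs : s ∈ Γ := Γ.mul_mem hg (Γ.inv_mem hh)
      refine ⟨⟨1, displacement z s⟩, ⟨rfl, Submodule.subset_span (hUz s hs hgh)⟩, ?_⟩
      have e : g.vec - displacement z s = adHom G s.rot h.vec - (displacement z s - s.vec) := by
        rw [show g = s * h from (inv_mul_cancel_right g h).symm, mul_vec]
        abel
      refine (congrArg norm e).trans_le ((norm_sub_le _ _).trans (add_le_add ?_ ?_))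
      · exact (norm_adHom _ _).trans_le hhr
      · exact norm_displacement_sub_vec_le z s
    exact ⟨translations W.toAddSubgroup, map_thetaBar_translations _, isConnected_translations W,
      hΓ.isProperPair.of_subset_mul (isCompact_norm_vec_le _) hW,
      hΓc.of_subset_mul (isCompact_norm_vec_le _) hΓW⟩
  · rintro ⟨L, hθ, -, hL, hLc⟩
    let A : AddSubgroup (pPart G) :=
      { carrier := {X | (⟨1, X⟩ : CartanMotionGroup G) ∈ L}
        zero_mem' := L.one_mem
        add_mem' := fun {X Y} hX hY => by
          have h := L.mul_mem hX hY
          rwa [show (⟨1, X⟩ * ⟨1, Y⟩ : CartanMotionGroup G) = ⟨1, X + Y⟩ from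
            CartanMotionGroup.ext (one_mul 1) (by simp)] at h
        neg_mem' := fun {X} hX => by
          have h := L.inv_mem hX
          rwa [show (⟨1, X⟩⁻¹ : CartanMotionGroup G) = ⟨1, -X⟩ from
            CartanMotionGroup.ext inv_one (by simp)] at h }
    have hvec : ∀ l ∈ L, l.vec ∈ Submodule.span ℝ (A : Set (pPart G)) := fun l hl => by
      have h1 : (⟨l.rot, -l.vec⟩ : CartanMotionGroup G) ∈ L := hθ ▸ ⟨l, hl, rfl⟩
      -- `l * (thetaBar l)⁻¹ = (1, 2 X)` for `l = (k, X)`.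
      have h2 : (2 : ℝ) • l.vec ∈ (A : Set (pPart G)) := by
        have h3 := L.mul_mem hl (L.inv_mem h1)
        rwa [show (l * ⟨l.rot, -l.vec⟩⁻¹ : CartanMotionGroup G) = ⟨1, (2 : ℝ) • l.vec⟩ from
          CartanMotionGroup.ext (mul_inv_cancel _) (by
            have h4 : adHom G l.rot (adHom G l.rot⁻¹ l.vec) = l.vec := by
              rw [← Module.End.mul_apply, ← map_mul]; simp
            simp [h4, two_smul])] at h3
      have h5 := Submodule.smul_mem _ (2⁻¹ : ℝ) (Submodule.subset_span (R := ℝ) h2)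
      rwa [smul_smul, inv_mul_cancel₀ two_ne_zero, one_smul] at h5
    obtain ⟨Λ, hΛA, hΛ, R, hR⟩ := A.exists_discrete_cobounded_in_span
    have := discreteTopology_translations Λ
    have hΛL : (translations Λ : Set (CartanMotionGroup G)) ⊆ L := fun g hg => by
      have h : (⟨1, g.vec⟩ : CartanMotionGroup G) ∈ L := hΛA hg.2
      rwa [show g = ⟨1, g.vec⟩ from CartanMotionGroup.ext hg.1 rfl]
    have hLΛ : (L : Set (CartanMotionGroup G)) ⊆
        (translations Λ : Set (CartanMotionGroup G)) * {g | ‖g.vec‖ ≤ R} :=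
      subset_mul_of_norm_vec_sub_le fun l hl => by
        obtain ⟨X, hX, hlX⟩ := hR l.vec (hvec l hl)
        exact ⟨⟨1, X⟩, ⟨rfl, hX⟩, hlX⟩
    have hproper : IsProperPair (translations Λ : Set (CartanMotionGroup G)) H :=
      hL.of_subset_mul isCompact_singleton (hΛL.trans_eq (by rw [Set.singleton_one, mul_one]))
    exact ⟨translations Λ,
      hproper.isDiscontinuousGroup eq_one_of_isOfFinOrder_of_mem_translations,
      hLc.of_subset_mul (isCompact_norm_vec_le R) hLΛ⟩
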